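/- Let $p(n)$ denote the number of partitions of $n$ and put $P=\sum_{n\ge 0}p(n)q^n$. The crank of a partition is its largest part if the partition contains no ones (so the crank of the empty partition is $0$), and otherwise it is the number of parts larger than the number of ones, minus the number of ones. For $k\in\mathbb Z$ and $n\ge 0$, $n\ne 1$, let $M(k,n)$ be the number of partitions of $n$ with crank $k$; for $n=1$ put $M(0,1)=-1$, $M(1,1)=M(-1,1)=1$ and $M(k,1)=0$ for all other $k$. For even $j\ge 2$ let $$C_j=\sum_{n\ge 1}\Big(\sum_{k\in\mathbb Z}k^j\,M(k,n)\Big)q^n .$$ For odd $j\ge 1$ let $\Phi_j=\sum_{n\ge 1}\sigma_j(n)q^n$, where $\sigma_j(n)=\sum_{d\mid n}d^j$. All of these are regarded as formal power series in $q$ with complex coefficients. Let $\delta_q=q\,\frac{d}{dq}$. For $N\ge 1$ let $\mathcal V_N$ be the complex vector space spanned by the monomials $\Phi_1^a\Phi_3^b\Phi_5^c$ with integers $a,b,c\ge 0$ and $a+2b+3c=N$, and let $\mathcal W_N=\sum_{k=1}^{N}\mathcal V_k$, i.e. the complex span of those monomials with $0<a+2b+3c\le N$. **Theorem 4.2.**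 For all integers $m\ge 0$ and $n\ge 1$ there exists $\Phi\in\mathcal W_{n+m}$ such that $$\delta_q^m\left(C_{2n}\right)=P\,\Phi .$$ -/

import Mathlib

open PowerSeries

namespace CrankMoments

/-- The crank of a partition: its largest part if it has no part equal to `1`; otherwise the
number of parts larger than the number of ones, minus the number of ones. -/
def crank {n : ℕ} (p : n.Partition) : ℤ :=
  if p.parts.count 1 = 0 then (p.parts.sup : ℤ)
  else (p.parts.countP (fun i => p.parts.count 1 < i) : ℤ) - (p.parts.count 1 : ℤ)

/-- `M(m, n)`: the number of partitions of `n` with crank `m`, with the customary amendment for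
`n = 1`, namely `M(0, 1) = -1`, `M(-1, 1) = M(1, 1) = 1` and `M(m, 1) = 0` otherwise. -/
def M (m : ℤ) (n : ℕ) : ℤ :=
  if n = 1 then (if m = 0 then -1 else if m = 1 ∨ m = -1 then 1 else 0)
  else ((Finset.univ.filter (fun p : n.Partition => crank p = m)).card : ℤ)

/-- For each `n`, only finitely many `M(m, n)` are nonzero, so that the sum defining the crank
moments is a genuine finite sum. -/
theorem finite_support_M (n : ℕ) : (Function.support (fun m : ℤ => M m n)).Finite := by
  by_cases hn : n = 1
  · refine Set.Finite.subset (Finset.finite_toSet ({0, 1, -1} : Finset ℤ)) ?_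
    intro m hm
    by_contra h
    simp only [Finset.coe_insert, Finset.coe_singleton, Set.mem_insert_iff,
      Set.mem_singleton_iff, not_or] at h
    exact hm (by simp [M, hn, h])
  · refine Set.Finite.subset (Set.finite_range (fun p : n.Partition => crank p)) ?_
    intro m hm
    by_contra h
    refine hm ?_
    simp only [Set.mem_range, not_exists] at h
    simp [M, hn, h]

/-- The crank moment `M_j(n) = ∑_k k^j M(k, n)`, the sum being over all integers `k`. -/
noncomputable def crankMoment (j n : ℕ) : ℤ := ∑ᶠ k : ℤ, k ^ j * M k n

/-- The generating function `C_j = ∑_{n ≥ 1} M_j(n) q^n` of the crank moments. -/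
noncomputable def C (j : ℕ) : ℂ⟦X⟧ :=
  PowerSeries.mk fun n => if 1 ≤ n then (crankMoment j n : ℂ) else 0

/-- The generating function `P = ∑_{n ≥ 0} p(n) q^n` of the partition function. -/
noncomputable def P : ℂ⟦X⟧ := PowerSeries.mk fun n => (Fintype.card n.Partition : ℂ)

/-- `Φ_j = ∑_{n ≥ 1} σ_j(n) q^n`, where `σ_j(n) = ∑_{d ∣ n} d^j`
(the coefficient at `n = 0` is `0`, since `Nat.divisors 0 = ∅`). -/
noncomputable def Phi (j : ℕ) : ℂ⟦X⟧ :=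
  PowerSeries.mk fun n => ∑ d ∈ n.divisors, (d : ℂ) ^ j

/-- The operator `δ_q = q d/dq` on formal power series. -/
noncomputable def deltaQ (f : ℂ⟦X⟧) : ℂ⟦X⟧ := X * PowerSeries.derivative ℂ f

/-- `V_n`: the complex span of the monomials `Φ_1^a Φ_3^b Φ_5^c` with `a + 2b + 3c = n`. -/
noncomputable def V (n : ℕ) : Submodule ℂ ℂ⟦X⟧ :=
  Submodule.span ℂ
    {f | ∃ a b c : ℕ, a + 2 * b + 3 * c = n ∧ f = Phi 1 ^ a * Phi 3 ^ b * Phi 5 ^ c}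

/-- `W_n = V_1 + ⋯ + V_n`, i.e. the complex span of the monomials `Φ_1^a Φ_3^b Φ_5^c` with
`0 < a + 2b + 3c ≤ n`. -/
noncomputable def W (n : ℕ) : Submodule ℂ ℂ⟦X⟧ := ⨆ k ∈ Finset.Icc 1 n, V k

end CrankMoments

open PowerSeries

namespace CrankMoments

/-! The spaces `U n` filter the algebra of level one quasimodular forms by half the weight, and `W
n` is the part of `U n` with zero constant term (`mem_W_iff`). Two facts carry the proof.

Modular side: `deltaQ` maps `U n` into `U (n + 1)` (`deltaQ_mem_U`), and `Phi (2 * k - 1)` lies in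
`U k` (`Phi_mem_U`). Every level one form of weight `2k` is a polynomial in `E₄`, `E₆`, hence in `U
k` (`qExpansion_mem_U`). The Serre derivative handles modular forms, and the modularity of `D E₂ -
E₂² / 12` handles `Φ_1`.

Crank side: the crank generating function is `(q)_∞ / ((zq)_∞ (q/z)_∞)` (`crankGen_mul_qInf`). Put
`z = e^t`. The coefficient of `t^j` is then `C_j / j!`, and the logarithmic `t`-derivative is a
combination of the odd `Φ_j` (`tCoeff_crankLog`). Comparing coefficients gives a recurrence that
yields `C_{2n} = P Φ` with `Φ ∈ W n`.

Finally `δ_q P = P Φ_1`, so `δ_q (P Φ) = P (δ_q Φ + Φ_1 Φ)`: each application of `δ_q` costs one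
step of the filtration. -/

/-! ### The weight filtration `U` and its relation to `W` -/

/-- The complex span of the monomials `Φ_1^a Φ_3^b Φ_5^c` with `a + 2b + 3c ≤ n`, including the
constants. -/
noncomputable def U (n : ℕ) : Submodule ℂ ℂ⟦X⟧ :=
  Submodule.span ℂ
    {f | ∃ a b c : ℕ, a + 2 * b + 3 * c ≤ n ∧ f = Phi 1 ^ a * Phi 3 ^ b * Phi 5 ^ c}

theorem monomial_mem_U {n a b c : ℕ} (h : a + 2 * b + 3 * c ≤ n) :
    Phi 1 ^ a * Phi 3 ^ b * Phi 5 ^ c ∈ U n :=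
  Submodule.subset_span ⟨a, b, c, h, rfl⟩

theorem U_mono {m n : ℕ} (h : m ≤ n) : U m ≤ U n := by
  refine Submodule.span_mono ?_
  rintro _ ⟨a, b, c, habc, rfl⟩
  exact ⟨a, b, c, habc.trans h, rfl⟩

theorem one_mem_U (n : ℕ) : (1 : ℂ⟦X⟧) ∈ U n := by
  simpa using monomial_mem_U (n := n) (a := 0) (b := 0) (c := 0) (by simp)

theorem mul_mem_U {m n : ℕ} {f g : ℂ⟦X⟧} (hf : f ∈ U m) (hg : g ∈ U n) : f * g ∈ U (m + n) := by
  have h := Submodule.mul_mem_mul hf hg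
  rw [U, U, Submodule.span_mul_span] at h
  refine Submodule.span_mono ?_ h
  rintro _ ⟨_, ⟨a, b, c, h₁, rfl⟩, _, ⟨a', b', c', h₂, rfl⟩, rfl⟩
  exact ⟨a + a', b + b', c + c', by lia, by simp only; ring⟩

theorem pow_mem_U {m : ℕ} {f : ℂ⟦X⟧} (hf : f ∈ U m) (k : ℕ) : f ^ k ∈ U (k * m) := by
  induction k with
  | zero => simpa using one_mem_U 0
  | succ k ih => rw [pow_succ, Nat.succ_mul]; exact mul_mem_U ih hf

theorem Phi_one_mem_U : Phi 1 ∈ U 1 := by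
  simpa using monomial_mem_U (n := 1) (a := 1) (b := 0) (c := 0) (by simp)

theorem Phi_three_mem_U : Phi 3 ∈ U 2 := by
  simpa using monomial_mem_U (n := 2) (a := 0) (b := 1) (c := 0) (by simp)

theorem Phi_five_mem_U : Phi 5 ∈ U 3 := by
  simpa using monomial_mem_U (n := 3) (a := 0) (b := 0) (c := 1) (by simp)

@[simp]
theorem constantCoeff_Phi (j : ℕ) : constantCoeff (Phi j) = 0 := by
  simp [Phi, ← coeff_zero_eq_constantCoeff_apply]

theorem V_le_W {k n : ℕ} (h₁ : 1 ≤ k) (h₂ : k ≤ n) : V k ≤ W n :=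
  le_iSup₂_of_le k (Finset.mem_Icc.mpr ⟨h₁, h₂⟩) le_rfl

theorem W_le_U (n : ℕ) : W n ≤ U n := by
  refine iSup₂_le fun k hk => Submodule.span_mono ?_
  rintro _ ⟨a, b, c, habc, rfl⟩
  exact ⟨a, b, c, habc.trans_le (Finset.mem_Icc.mp hk).2, rfl⟩

/-- Every `Φ_j` has zero constant term, so the only generator of `U n` outside `W n` is the monomial
`1`, which the subtraction removes. -/
theorem sub_constantCoeff_mem_W {n : ℕ} {f : ℂ⟦X⟧} (hf : f ∈ U n) :
    f - PowerSeries.C (constantCoeff f) ∈ W n := by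
  induction hf using Submodule.span_induction with
  | mem f hf =>
    obtain ⟨a, b, c, habc, rfl⟩ := hf
    by_cases h0 : a = 0 ∧ b = 0 ∧ c = 0
    · obtain ⟨rfl, rfl, rfl⟩ := h0
      simp
    · have h : constantCoeff (Phi 1 ^ a * Phi 3 ^ b * Phi 5 ^ c) = 0 := by
        simp only [map_mul, map_pow, constantCoeff_Phi, zero_pow_eq]
        grind
      rw [h, map_zero, sub_zero]
      exact V_le_W (by lia) habc (Submodule.subset_span ⟨a, b, c, rfl, rfl⟩)
  | zero => simp
  | add f g _ _ hf hg =>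
    rw [map_add, map_add, add_sub_add_comm]
    exact add_mem hf hg
  | smul x f _ hf =>
    convert! (W n).smul_mem x hf using 1
    simp [smul_sub, smul_eq_C_mul]

theorem mem_W_of_mem_U {n : ℕ} {f : ℂ⟦X⟧} (hf : f ∈ U n) (h0 : constantCoeff f = 0) :
    f ∈ W n := by
  simpa [h0] using sub_constantCoeff_mem_W hf

/-- This allows all weight estimates to be made in `U`, which contains `1` and is multiplicative;
positivity of the weight is recovered at the end from the constant term. -/
theorem mem_W_iff {n : ℕ} {f : ℂ⟦X⟧} : f ∈ W n ↔ f ∈ U n ∧ constantCoeff f = 0 := by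
  refine ⟨fun h => ⟨W_le_U n h, ?_⟩, fun h => mem_W_of_mem_U h.1 h.2⟩
  suffices h : W n ≤ LinearMap.ker (coeff 0 : ℂ⟦X⟧ →ₗ[ℂ] ℂ) by simpa using h ‹_›
  refine iSup₂_le fun k hk => Submodule.span_le.mpr ?_
  rintro _ ⟨a, b, c, habc, rfl⟩
  have := (Finset.mem_Icc.mp hk).1
  simp only [SetLike.mem_coe, LinearMap.mem_ker, coeff_zero_eq_constantCoeff, map_mul, map_pow,
    constantCoeff_Phi, zero_pow_eq]
  grind

/-- `deltaQ` as a derivation. -/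
noncomputable def deltaDerivation : Derivation ℂ ℂ⟦X⟧ ℂ⟦X⟧ := (X : ℂ⟦X⟧) • derivative ℂ

theorem deltaDerivation_apply (f : ℂ⟦X⟧) : deltaDerivation f = deltaQ f := by
  simp [deltaDerivation, deltaQ]

theorem deltaQ_mul (f g : ℂ⟦X⟧) : deltaQ (f * g) = f * deltaQ g + g * deltaQ f := by
  simp [← deltaDerivation_apply, Derivation.leibniz]

theorem coeff_deltaQ (f : ℂ⟦X⟧) (n : ℕ) : coeff n (deltaQ f) = n * coeff n f := by
  cases n with
  | zero => simp [deltaQ]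
  | succ n => simp [deltaQ, coeff_succ_X_mul, coeff_derivative, mul_comm]

/-! ### Level one quasimodular forms and the action of `δ_q` -/

section Modular

open UpperHalfPlane ModularForm MatrixGroups Function
open scoped Manifold Derivative

/-- A holomorphic function on the upper half plane given by the power series `a` in
`q = exp (2πiτ)`. -/
structure HasQSeries (F : ℍ → ℂ) (a : ℂ⟦X⟧) : Prop where
  mdifferentiable : MDiff F
  hasSum (τ : ℍ) : HasSum (fun m : ℕ => coeff m a • Periodic.qParam 1 τ ^ m) (F τ)

namespace HasQSeries

variable {F G : ℍ → ℂ} {a b : ℂ⟦X⟧}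

theorem isBoundedAtImInfty (h : HasQSeries F a) : IsBoundedAtImInfty F :=
  isBoundedAtImInfty_of_hasSum_qExpansion one_pos h.hasSum

theorem periodic (h : HasQSeries F a) : Periodic (F ∘ ofComplex) ((1 : ℝ) : ℂ) := by
  intro w
  by_cases! hw : 0 < w.im
  · have hw' : 0 < (w + ((1 : ℝ) : ℂ)).im := by simpa using hw
    simp only [comp_apply, ofComplex_apply_of_im_pos hw, ofComplex_apply_of_im_pos hw']
    refine (h.hasSum _).unique ?_
    convert! h.hasSum ⟨w, hw⟩ using 4
    simpa [Periodic.qParam, mul_add] using (Complex.exp_periodic (2 * Real.pi * Complex.I * w))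
  -- Off the upper half plane `ofComplex` takes a single default value.
  · have hw' : (w + ((1 : ℝ) : ℂ)).im ≤ 0 := by simpa using hw
    simp only [comp_apply, ofComplex_apply_of_im_nonpos hw, ofComplex_apply_of_im_nonpos hw']

theorem analyticAt (h : HasQSeries F a) : AnalyticAt ℂ (cuspFunction 1 F) 0 :=
  analyticAt_cuspFunction_zero one_pos h.periodic h.mdifferentiable h.isBoundedAtImInfty

/-- Uniqueness of the Taylor series of the cusp function at `q = 0`. -/
theorem qExpansion_eq (h : HasQSeries F a) : qExpansion 1 F = a := by
  ext m
  have h₁ := (hasFPowerSeriesOnBall_cuspFunction one_pos h.analyticAt h.hasSum).hasFPowerSeriesAt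
  have h₂ := h.analyticAt.hasFPowerSeriesAt
  have h₃ := congr_arg (FormalMultilinearSeries.coeff · m) (h₂.eq_formalMultilinearSeries h₁)
  simpa [qExpansion_coeff, div_eq_inv_mul] using h₃

theorem of_periodic (hd : MDiff F) (hb : IsBoundedAtImInfty F)
    (hp : Periodic (F ∘ ofComplex) ((1 : ℝ) : ℂ)) : HasQSeries F (qExpansion 1 F) :=
  ⟨hd, hasSum_qExpansion one_pos hp hd hb⟩

theorem of_modularForm {k : ℤ} (f : ModularForm 𝒮ℒ k) : HasQSeries f (qExpansion 1 f) :=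
  ⟨f.holo', fun τ => ModularForm.hasSum_qExpansion f one_pos one_mem_strictPeriods_SL τ⟩

theorem mul (hF : HasQSeries F a) (hG : HasQSeries G b) : HasQSeries (F * G) (a * b) := by
  have h := of_periodic (hF.mdifferentiable.mul hG.mdifferentiable)
    (hF.isBoundedAtImInfty.mul hG.isBoundedAtImInfty) (hF.periodic.mul hG.periodic)
  rwa [qExpansion_mul hF.analyticAt hG.analyticAt, hF.qExpansion_eq, hG.qExpansion_eq] at h

theorem sub (hF : HasQSeries F a) (hG : HasQSeries G b) : HasQSeries (F - G) (a - b) where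
  mdifferentiable := hF.mdifferentiable.sub hG.mdifferentiable
  hasSum τ := by simpa [sub_mul] using (hF.hasSum τ).sub (hG.hasSum τ)

theorem const_smul (c : ℂ) (hF : HasQSeries F a) : HasQSeries (c • F) (c • a) where
  mdifferentiable := hF.mdifferentiable.const_smul c
  hasSum τ := by simpa [mul_assoc] using (hF.hasSum τ).mul_left c

/-- Write `F(τ) = g(q)` with `g` the cusp function; since `dq/dτ = 2πi q`, the chain rule gives `D F
= q g'(q)`, and the Taylor series of `g'` supplies the coefficients. -/
theorem normalizedDeriv (hF : HasQSeries F a) : HasQSeries (D F) (deltaQ a) where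
  mdifferentiable := Derivative.normalizedDerivOfComplex_mdifferentiable hF.mdifferentiable
  hasSum τ := by
    set g := cuspFunction 1 F with hg
    have hdiff : DifferentiableOn ℂ g (Metric.ball 0 1) :=
      differentiableOn_cuspFunction_ball one_pos hF.periodic hF.mdifferentiable
        hF.isBoundedAtImInfty
    set q := Periodic.qParam 1 (τ : ℂ) with hq
    have hq1 : q ∈ Metric.ball (0 : ℂ) 1 := by
      simpa using Periodic.norm_qParam_lt_one one_pos τ.im_pos
    have hDF : D F τ = q * deriv g q := by
      have hev : F ∘ ofComplex =ᶠ[nhds (τ : ℂ)] fun w => g (Periodic.qParam 1 w) := by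
        filter_upwards [isOpen_upperHalfPlaneSet.mem_nhds τ.im_pos] with w hw
        have := UpperHalfPlane.eq_cuspFunction (h := 1) ⟨w, hw⟩ one_ne_zero hF.periodic
        simp only [comp_apply, ofComplex_apply_of_im_pos hw]
        exact this.symm
      have hgd : HasDerivAt g (deriv g q) (Periodic.qParam 1 (τ : ℂ)) :=
        (hdiff.differentiableAt (Metric.isOpen_ball.mem_nhds hq1)).hasDerivAt
      have hqd : HasDerivAt (Periodic.qParam 1) (q * (2 * Real.pi * Complex.I)) (τ : ℂ) := by
        have h1 : HasDerivAt (fun w : ℂ => 2 * Real.pi * Complex.I * w / ((1 : ℝ) : ℂ))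
            (2 * Real.pi * Complex.I) (τ : ℂ) := by
          simpa using (hasDerivAt_id (τ : ℂ)).const_mul (2 * Real.pi * Complex.I)
        exact h1.cexp
      rw [Derivative.normalizedDerivOfComplex, hev.deriv_eq, show deriv (fun w => g (Periodic.qParam 1 w)) (τ : ℂ) = _ from
        (hgd.comp (τ : ℂ) hqd).deriv]
      field [Complex.two_pi_I_ne_zero]
    have hsum := (Complex.hasSum_taylorSeries_on_ball (hdiff.deriv Metric.isOpen_ball)
      hq1).mul_left q
    -- The term of index `0` vanishes, so the series may be shifted to match `q` times the series of
    -- `g'`.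
    rw [hDF, ← hasSum_nat_add_iff' 1]
    simp only [Finset.range_one, Finset.sum_singleton, coeff_deltaQ]
    simp only [Nat.cast_zero, zero_mul, zero_smul, sub_zero]
    convert! hsum using 2 with m
    rw [← iteratedDeriv_succ', ← hF.qExpansion_eq, qExpansion_coeff, sub_zero, ← hg]
    have := Nat.cast_ne_zero (R := ℂ).mpr m.factorial_ne_zero
    have h2 : (m : ℂ) + 1 ≠ 0 := by exact_mod_cast m.succ_ne_zero
    simp only [Nat.factorial_succ, smul_eq_mul]
    push_cast
    field

end HasQSeries

theorem Phi_eq_mk_sigma (j : ℕ) :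
    Phi j = PowerSeries.mk fun n => (ArithmeticFunction.sigma j n : ℂ) := by
  ext n
  simp [Phi, ArithmeticFunction.sigma_apply]

theorem qExpansion_E {k : ℕ} (hk : 3 ≤ k) (hk2 : Even k) :
    qExpansion 1 (E hk) = 1 + (-(2 * k / bernoulli k) : ℂ) • Phi (k - 1) := by
  ext m
  rw [EisensteinSeries.E_qExpansion_coeff hk hk2, Phi_eq_mk_sigma]
  rcases eq_or_ne m 0 with rfl | hm
  · simp
  · simp [hm, coeff_one]

theorem qExpansion_E₄_mem_U : qExpansion 1 E₄ ∈ U 2 := by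
  rw [qExpansion_E _ ⟨2, rfl⟩]
  exact add_mem (one_mem_U 2) ((U 2).smul_mem _ Phi_three_mem_U)

theorem qExpansion_E₆_mem_U : qExpansion 1 E₆ ∈ U 3 := by
  rw [qExpansion_E _ ⟨3, rfl⟩]
  exact add_mem (one_mem_U 3) ((U 3).smul_mem _ Phi_five_mem_U)

theorem qExpansion_discriminant_mem_U : qExpansion 1 discriminant ∈ U 6 := by
  have h : HasQSeries discriminant ((1 / 1728 : ℂ) • (qExpansion 1 E₄ * (qExpansion 1 E₄ *
      qExpansion 1 E₄) - qExpansion 1 E₆ * qExpansion 1 E₆)) := by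
    have h4 := HasQSeries.of_modularForm E₄
    have h6 := HasQSeries.of_modularForm E₆
    convert! ((h4.mul (h4.mul h4)).sub (h6.mul h6)).const_smul (1 / 1728) using 1
    ext z
    simp only [discriminant_eq_E₄_cube_sub_E₆_sq, Pi.smul_apply, Pi.sub_apply, Pi.mul_apply,
      smul_eq_mul]
    ring
  rw [h.qExpansion_eq]
  have h4 := mul_mem_U qExpansion_E₄_mem_U (mul_mem_U qExpansion_E₄_mem_U qExpansion_E₄_mem_U)
  have h6 := mul_mem_U qExpansion_E₆_mem_U qExpansion_E₆_mem_U
  norm_num only at h4 h6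
  exact (U 6).smul_mem _ (sub_mem h4 h6)

/-- In every even weight at least `4` there is a level one form in `U` with constant term `1`. -/
theorem exists_modularForm_coeff_zero_eq_one {k : ℕ} (hk : 2 ≤ k) :
    ∃ g : ModularForm 𝒮ℒ (2 * k : ℤ), qExpansion 1 g ∈ U k ∧ (qExpansion 1 g).coeff 0 = 1 := by
  obtain ⟨a, b, rfl⟩ : ∃ a b : ℕ, k = a * 2 + b * 3 := by
    rcases Nat.even_or_odd' k with ⟨c, rfl | rfl⟩
    · exact ⟨c, 0, by lia⟩
    · exact ⟨c - 1, 1, by lia⟩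
  have hexp : qExpansion 1 ((E₄.pow a).mul (E₆.pow b)) =
      qExpansion 1 E₄ ^ a * qExpansion 1 E₆ ^ b := by
    rw [ModularForm.qExpansion_mul one_pos one_mem_strictPeriods_SL,
      ModularForm.qExpansion_pow one_pos one_mem_strictPeriods_SL,
      ModularForm.qExpansion_pow one_pos one_mem_strictPeriods_SL]
  refine ⟨ModularForm.mcast (by push_cast; ring) ((E₄.pow a).mul (E₆.pow b)), ?_, ?_⟩
  · rw [ModularForm.coe_mcast, hexp]
    exact mul_mem_U (pow_mem_U qExpansion_E₄_mem_U a) (pow_mem_U qExpansion_E₆_mem_U b)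
  · have h4 := EisensteinSeries.E_qExpansion_coeff_zero (k := 4) (by simp) ⟨2, rfl⟩
    have h6 := EisensteinSeries.E_qExpansion_coeff_zero (k := 6) (by simp) ⟨3, rfl⟩
    rw [coeff_zero_eq_constantCoeff_apply] at h4 h6
    rw [ModularForm.coe_mcast, hexp, coeff_zero_eq_constantCoeff_apply, map_mul, map_pow, map_pow,
      h4, h6, one_pow, one_pow, one_mul]

/-- Subtracting a multiple of some `E₄^a E₆^b` leaves a cusp form; dividing by the discriminant
lowers the weight by `12`, that is, `k` by `6`, and induction applies. Weights `0` and `2` are the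
base cases. -/
theorem qExpansion_mem_U (k : ℕ) (f : ModularForm 𝒮ℒ (2 * k : ℤ)) : qExpansion 1 f ∈ U k := by
  induction k using Nat.strong_induction_on with | h k ih =>
  rcases lt_or_ge k 2 with hk | hk
  · interval_cases k
    · obtain ⟨c, hc⟩ := ModularFormClass.levelOne_weight_zero_const
        (ModularForm.mcast (b := 0) (by simp) f)
      have : (f : ℍ → ℂ) = c • (1 : ℍ → ℂ) := by
        rw [ModularForm.coe_mcast] at hc
        rw [hc]
        ext
        simp
      rw [this, ← ModularForm.one_coe_eq_one (Γ := 𝒮ℒ),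
        ModularForm.qExpansion_smul one_pos one_mem_strictPeriods_SL, ModularForm.qExpansion_one]
      exact (U 0).smul_mem _ (one_mem_U 0)
    · have := rank_zero_iff_forall_zero.mp levelOne_weight_two_rank_zero
        (ModularForm.mcast (b := 2) (by simp) f)
      have h0 : (f : ℍ → ℂ) = 0 := by
        rw [← ModularForm.coe_mcast (b := 2) (by simp) f, this]
        rfl
      rw [h0, qExpansion_zero]
      exact zero_mem _
  obtain ⟨g, hgU, hg1⟩ := exists_modularForm_coeff_zero_eq_one hk
  obtain ⟨F, hF⟩ : ∃ F : ModularForm 𝒮ℒ (2 * k : ℤ), qExpansion 1 F =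
      qExpansion 1 f - (qExpansion 1 f).coeff 0 • qExpansion 1 g := by
    refine ⟨f - (qExpansion 1 f).coeff 0 • g, ?_⟩
    rw [FunLike.coe_sub, ModularForm.qExpansion_sub one_pos one_mem_strictPeriods_SL,
      FunLike.coe_smul, ModularForm.qExpansion_smul one_pos one_mem_strictPeriods_SL]
  have hcusp : (qExpansion 1 F).coeff 0 = 0 := by
    rw [hF, map_sub, coeff_smul, hg1, smul_eq_mul, mul_one, sub_self]
  have hmem : qExpansion 1 F ∈ U k := by
    rw [ModularForm.qExpansion_eq_qExpansion_discriminant_mul _ hcusp]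
    generalize CuspForm.discriminantEquiv (toCuspForm F hcusp) = h
    rcases lt_or_ge k 6 with hk6 | hk6
    -- For `k < 6` the quotient by the discriminant has negative weight.
    · have : (h : ℍ → ℂ) = 0 := ModularFormClass.levelOne_neg_weight_eq_zero (by lia) h
      rw [this, qExpansion_zero, mul_zero]
      exact zero_mem _
    · obtain ⟨l, rfl⟩ := Nat.exists_eq_add_of_le hk6
      have := ih l (by lia) (ModularForm.mcast (by push_cast; ring) h)
      rw [ModularForm.coe_mcast] at this
      exact mul_mem_U qExpansion_discriminant_mem_U this
  rw [← sub_add_cancel (qExpansion 1 f) ((qExpansion 1 f).coeff 0 • qExpansion 1 g), ← hF]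
  exact add_mem hmem ((U k).smul_mem _ hgU)

/-- A `q`-series gives boundedness at infinity, and slash invariance carries it to every cusp, so
`F` is a modular form. -/
theorem HasQSeries.mem_U {F : ℍ → ℂ} {a : ℂ⟦X⟧} {k : ℕ} (h : HasQSeries F a)
    (hF : ∀ γ : SL(2, ℤ), F ∣[(2 * k : ℤ)] γ = F) : a ∈ U k := by
  rw [← h.qExpansion_eq]
  exact qExpansion_mem_U k
    { toFun := F
      slash_action_eq' := by
        rintro _ ⟨γ, rfl⟩
        exact hF γ
      holo' := h.mdifferentiable
      bdd_at_cusps' := fun {c} hc => by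
        rw [Subgroup.IsArithmetic.isCusp_iff_isCusp_SL2Z] at hc
        rw [OnePoint.isBoundedAt_iff_forall_SL2Z hc]
        intro γ _
        rw [hF γ]
        exact h.isBoundedAtImInfty }

theorem hasQSeries_E2 :
    HasQSeries EisensteinSeries.E2 (1 + (-24 : ℂ) • Phi 1) where
  mdifferentiable := E2_mdifferentiable
  hasSum τ := by
    convert! EisensteinSeries.hasSum_qExpansion_E2 (z := τ) using 2 with m
    rw [Phi_eq_mk_sigma]
    rcases eq_or_ne m 0 with rfl | hm
    · simp
    · simp [hm, coeff_one, Periodic.qParam]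

theorem qSeries_E2_mem_U : 1 + (-24 : ℂ) • Phi 1 ∈ U 1 :=
  add_mem (one_mem_U 1) ((U 1).smul_mem _ Phi_one_mem_U)

/-- The Serre derivative `D F - (2k/12) E₂ F` is modular of weight `2k + 2`, and `E₂ F` has weight
`k + 1` in the filtration. -/
theorem deltaQ_mem_U_of_slash_invariant {F : ℍ → ℂ} {a : ℂ⟦X⟧} {k : ℕ} (h : HasQSeries F a)
    (hF : ∀ γ : SL(2, ℤ), F ∣[(2 * k : ℤ)] γ = F) : deltaQ a ∈ U (k + 1) := by
  have hS : HasQSeries (Derivative.serreDerivative ((2 * k : ℤ) : ℂ) F)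
      (deltaQ a - ((2 * k : ℤ) * 12⁻¹ : ℂ) • ((1 + (-24 : ℂ) • Phi 1) * a)) := by
    convert! h.normalizedDeriv.sub ((hasQSeries_E2.mul h).const_smul ((2 * k : ℤ) * 12⁻¹)) using 1
    ext z
    simp [mul_assoc]
  have hS' := hS.mem_U (k := k + 1) fun γ => by
    rw [show (2 * (k + 1 : ℕ) : ℤ) = 2 * k + 2 by push_cast; ring]
    exact Derivative.serreDerivative_slash_invariant h.mdifferentiable (hF γ)
  have hE := (U (k + 1)).smul_mem ((2 * k : ℤ) * 12⁻¹ : ℂ)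
    (add_comm 1 k ▸ mul_mem_U qSeries_E2_mem_U (h.mem_U hF))
  simpa using add_mem hS' hE

theorem slash_eq_self {k : ℤ} (f : ModularForm 𝒮ℒ k) (γ : SL(2, ℤ)) : (f : ℍ → ℂ) ∣[k] γ = f :=
  f.slash_action_eq' _ ⟨γ, rfl⟩

theorem hasDerivAt_D2 (γ : SL(2, ℤ)) (z : ℍ) :
    HasDerivAt (EisensteinSeries.D2 γ ∘ ofComplex)
      (-(2 * Real.pi * Complex.I * γ 1 0 ^ 2 / denom γ z ^ 2)) z := by
  have hev : EisensteinSeries.D2 γ ∘ ofComplex =ᶠ[nhds (z : ℂ)]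
      fun w => (2 * Real.pi * Complex.I * γ 1 0) * denom γ w ^ (-1 : ℤ) := by
    filter_upwards [isOpen_upperHalfPlaneSet.mem_nhds z.im_pos] with w hw
    simp [EisensteinSeries.D2, ofComplex_apply_of_im_pos hw, div_eq_mul_inv]
  refine HasDerivAt.congr_of_eventuallyEq ?_ hev
  convert! (hasDerivAt_denom_zpow (γ : GL (Fin 2) ℝ) (-1) z).const_mul
    (2 * Real.pi * Complex.I * γ 1 0) using 1
  rw [show (-1 - 1 : ℤ) = -(2 : ℕ) by norm_num, zpow_neg, zpow_natCast]
  simp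
  ring

theorem mdifferentiable_D2 (γ : SL(2, ℤ)) : MDiff (EisensteinSeries.D2 γ) := fun z =>
  mdifferentiableAt_iff.mpr (hasDerivAt_D2 γ z).differentiableAt

theorem normalizedDeriv_D2 (γ : SL(2, ℤ)) (z : ℍ) :
    D (EisensteinSeries.D2 γ) z = -((γ 1 0 : ℂ) ^ 2 / denom γ z ^ 2) := by
  rw [Derivative.normalizedDerivOfComplex, (hasDerivAt_D2 γ z).deriv]
  field [Complex.two_pi_I_ne_zero, denom_ne_zero (γ : GL (Fin 2) ℝ) z]

/-- The combination `D E₂ - E₂² / 12` is modular of weight `4`. -/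
theorem normalizedDeriv_E2_sub_slash (γ : SL(2, ℤ)) :
    (D EisensteinSeries.E2 - (12⁻¹ : ℂ) • (EisensteinSeries.E2 * EisensteinSeries.E2))
      ∣[(4 : ℤ)] γ =
    D EisensteinSeries.E2 - (12⁻¹ : ℂ) • (EisensteinSeries.E2 * EisensteinSeries.E2) := by
  ext z
  have hE := EisensteinSeries.E2_slash_action γ
  have hD := congrFun (Derivative.normalizedDerivOfComplex_SL_slash (k := 2)
    E2_mdifferentiable (γ := γ)) z
  rw [hE, Derivative.normalizedDerivOfComplex_sub _ _ E2_mdifferentiable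
    ((mdifferentiable_D2 γ).const_smul _),
    Derivative.normalizedDerivOfComplex_smul _ _ (mdifferentiable_D2 γ)] at hD
  have hmul := congrFun (ModularForm.mul_slash_SL2 2 2 γ EisensteinSeries.E2 EisensteinSeries.E2) z
  norm_num only at hmul hD
  have hz := denom_ne_zero (γ : GL (Fin 2) ℝ) z
  have hπ : (Real.pi : ℂ) ≠ 0 := by exact_mod_cast Real.pi_ne_zero
  rw [sub_eq_add_neg, SlashAction.add_slash, SlashAction.neg_slash, ModularForm.SL_smul_slash]
  simp only [Pi.add_apply, Pi.neg_apply, Pi.smul_apply, Pi.sub_apply, Pi.mul_apply, smul_eq_mul,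
    hE, normalizedDeriv_D2, riemannZeta_two, EisensteinSeries.D2] at hD hmul ⊢
  rw [hmul]
  have hI : (2 * Real.pi * Complex.I : ℂ)⁻¹ = -Complex.I / (2 * Real.pi) := by
    rw [mul_inv, Complex.inv_I]
    ring
  rw [hI] at hD
  generalize D EisensteinSeries.E2 z = x at *
  generalize (D EisensteinSeries.E2 ∣[(4 : ℤ)] γ) z = y at *
  generalize EisensteinSeries.E2 z = e at *
  have hc : 1 / (2 * ((Real.pi : ℂ) ^ 2 / 6)) = 3 / (Real.pi : ℂ) ^ 2 := by
    field
  rw [hc] at hD ⊢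
  rw [mul_div_assoc (2 * (Real.pi : ℂ) * Complex.I)] at hD ⊢
  rw [← div_pow] at hD
  generalize ((γ 1 0 : ℤ) : ℂ) / _ = u at *
  have h1 : 3 / (Real.pi : ℂ) ^ 2 * (2 * Real.pi * Complex.I * u) =
      6 * Complex.I * u / Real.pi := by
    field
  rw [h1] at hD ⊢
  -- Here `u = c/(cz+d)` and `E₂ ∣ γ` is `e - 6iu/π`; both `y - x` and the change in `E₂²/12` equal
  -- `-iue/π - 3u²/π²`.
  linear_combination -hD + 3 * u ^ 2 / (Real.pi : ℂ) ^ 2 * Complex.I_sq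

theorem deltaQ_add (f g : ℂ⟦X⟧) : deltaQ (f + g) = deltaQ f + deltaQ g := by
  simp [← deltaDerivation_apply]

theorem deltaQ_smul (c : ℂ) (f : ℂ⟦X⟧) : deltaQ (c • f) = c • deltaQ f := by
  simp [← deltaDerivation_apply]

@[simp]
theorem deltaQ_one : deltaQ 1 = 0 := by
  simp [← deltaDerivation_apply]

theorem smul_mem_U_iff {n : ℕ} {c : ℂ} (hc : c ≠ 0) {f : ℂ⟦X⟧} : c • f ∈ U n ↔ f ∈ U n :=
  (U n).smul_mem_iff hc

theorem deltaQ_Phi_one_mem_U : deltaQ (Phi 1) ∈ U 2 := by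
  have h := ((hasQSeries_E2.normalizedDeriv).sub
    ((hasQSeries_E2.mul hasQSeries_E2).const_smul (12⁻¹ : ℂ))).mem_U (k := 2)
    normalizedDeriv_E2_sub_slash
  have hE2 := mul_mem_U qSeries_E2_mem_U qSeries_E2_mem_U
  have hE := (U 2).smul_mem (12⁻¹ : ℂ) hE2
  have h' := add_mem h hE
  rw [sub_add_cancel, deltaQ_add, deltaQ_smul, deltaQ_one, zero_add] at h'
  exact (smul_mem_U_iff (by norm_num)).mp h'

/-- With `bernoulli k = 0` the expansion formula, where division by zero gives `0`, would make `E_k`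
the constant `1`, impossible in nonzero weight. The nonvanishing allows `Φ_{k-1}` to be isolated
from `E_k`. -/
theorem bernoulli_ne_zero_of_even {k : ℕ} (hk : 3 ≤ k) (hk2 : Even k) : bernoulli k ≠ 0 := by
  intro h0
  have h1 : qExpansion 1 (E hk) = 1 := by simp [qExpansion_E hk hk2, h0]
  have hE : ((E hk : ModularForm 𝒮ℒ k) : ℍ → ℂ) = Function.const _ 1 := by
    ext z
    refine ((HasQSeries.of_modularForm (E hk)).hasSum z).unique ?_
    rw [h1]
    simpa using hasSum_single (f := fun m => coeff m (1 : ℂ⟦X⟧) • Periodic.qParam 1 (z : ℂ) ^ m) 0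
      fun m hm => by simp [coeff_one, hm]
  rcases SlashInvariantForm.wt_eq_zero_of_eq_const _ hE with h | h
  · lia
  · exact one_ne_zero h

theorem qExpansion_E_coeff_ne_zero {k : ℕ} (hk : 3 ≤ k) (hk2 : Even k) :
    (-(2 * k / bernoulli k) : ℂ) ≠ 0 := by
  have h : (bernoulli k : ℂ) ≠ 0 := by exact_mod_cast bernoulli_ne_zero_of_even hk hk2
  have h' : (k : ℂ) ≠ 0 := by exact_mod_cast (by lia : k ≠ 0)
  simp [h, h']

/-- The Eisenstein series of every even weight `2k` lies in `U k`. -/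
theorem Phi_mem_U {k : ℕ} (hk : 1 ≤ k) : Phi (2 * k - 1) ∈ U k := by
  rcases hk.eq_or_lt with rfl | hk
  · exact Phi_one_mem_U
  have hk3 : 3 ≤ 2 * k := by lia
  have h := (HasQSeries.of_modularForm (E hk3)).mem_U (k := k) fun γ => by
    simpa using slash_eq_self (E hk3) γ
  rw [qExpansion_E hk3 (even_two_mul k)] at h
  have h' := sub_mem h (one_mem_U k)
  rw [add_sub_cancel_left] at h'
  exact (smul_mem_U_iff (qExpansion_E_coeff_ne_zero hk3 (even_two_mul k))).mp h'

theorem deltaQ_Phi_mem_U {k : ℕ} (hk : 1 ≤ k) : deltaQ (Phi (2 * k - 1)) ∈ U (k + 1) := by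
  rcases hk.eq_or_lt with rfl | hk
  · exact deltaQ_Phi_one_mem_U
  have hk3 : 3 ≤ 2 * k := by lia
  have h := deltaQ_mem_U_of_slash_invariant (k := k) (HasQSeries.of_modularForm (E hk3))
    fun γ => by simpa using slash_eq_self (E hk3) γ
  rw [qExpansion_E hk3 (even_two_mul k), deltaQ_add, deltaQ_smul, deltaQ_one, zero_add] at h
  exact (smul_mem_U_iff (qExpansion_E_coeff_ne_zero hk3 (even_two_mul k))).mp h

theorem deltaQ_mul_mem_U {m n : ℕ} {f g : ℂ⟦X⟧} (hf : f ∈ U m) (hf' : deltaQ f ∈ U (m + 1))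
    (hg : g ∈ U n) (hg' : deltaQ g ∈ U (n + 1)) : deltaQ (f * g) ∈ U (m + n + 1) := by
  rw [deltaQ_mul]
  refine add_mem (U_mono (by lia) (mul_mem_U hf hg')) (U_mono (by lia) (mul_mem_U hg hf'))

theorem deltaQ_pow_mem_U {m : ℕ} {f : ℂ⟦X⟧} (hf : f ∈ U m) (hf' : deltaQ f ∈ U (m + 1)) (k : ℕ) :
    deltaQ (f ^ k) ∈ U (k * m + 1) := by
  induction k with
  | zero => simp
  | succ k ih => rw [pow_succ, Nat.succ_mul]; exact deltaQ_mul_mem_U (pow_mem_U hf k) ih hf hf'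

/-- By the Leibniz rule it suffices that `δ_q` raises the filtration by one on `Φ_1`, `Φ_3` and
`Φ_5`. -/
theorem deltaQ_mem_U {n : ℕ} {f : ℂ⟦X⟧} (hf : f ∈ U n) : deltaQ f ∈ U (n + 1) := by
  induction hf using Submodule.span_induction with
  | mem f hf =>
    obtain ⟨a, b, c, habc, rfl⟩ := hf
    have h1 := deltaQ_pow_mem_U Phi_one_mem_U (deltaQ_Phi_mem_U (k := 1) (by simp)) a
    have h3 := deltaQ_pow_mem_U Phi_three_mem_U (deltaQ_Phi_mem_U (k := 2) (by simp)) b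
    have h5 := deltaQ_pow_mem_U Phi_five_mem_U (deltaQ_Phi_mem_U (k := 3) (by simp)) c
    have m1 := pow_mem_U Phi_one_mem_U a
    have m3 := pow_mem_U Phi_three_mem_U b
    have m5 := pow_mem_U Phi_five_mem_U c
    exact U_mono (by lia)
      (deltaQ_mul_mem_U (mul_mem_U m1 m3) (deltaQ_mul_mem_U m1 h1 m3 h3) m5 h5)
  | zero => simp [← deltaDerivation_apply]
  | add f g _ _ hf hg => rw [deltaQ_add]; exact add_mem hf hg
  | smul x f _ hf => rw [deltaQ_smul]; exact (U _).smul_mem x hf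

end Modular

/-! ### `q`-series, infinite products and the `q`-binomial theorem -/

section CrankProduct

open Filter Finset
open scoped PowerSeries.WithPiTopology Topology

section QSeries

variable {B : Type*} [CommRing B]

/-- The finite product `∏_{i=1}^n (1 - a q^i)`. -/
noncomputable def qPoch (a : B) (n : ℕ) : B⟦X⟧ := ∏ i ∈ range n, (1 - a • X ^ (i + 1))

@[simp]
theorem qPoch_zero (a : B) : qPoch a 0 = 1 := by simp [qPoch]

theorem qPoch_succ (a : B) (n : ℕ) : qPoch a (n + 1) = qPoch a n * (1 - a • X ^ (n + 1)) := by
  simp [qPoch, prod_range_succ]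

theorem constantCoeff_qPoch (a : B) (n : ℕ) : constantCoeff (qPoch a n) = 1 := by
  simp [qPoch, map_prod, smul_eq_C_mul]

/-- The inverse of `∏_{i=1}^n (1 - q^i)`. -/
noncomputable def qFactInv (B : Type*) [CommRing B] (n : ℕ) : B⟦X⟧ := invOfUnit (qPoch (1 : B) n) 1

theorem qPoch_one_mul_qFactInv (n : ℕ) : qPoch (1 : B) n * qFactInv B n = 1 :=
  mul_invOfUnit _ _ (by simp [constantCoeff_qPoch])

@[simp]
theorem qFactInv_zero : qFactInv B 0 = 1 := by
  simpa using qPoch_one_mul_qFactInv (B := B) 0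

theorem qFactInv_succ (n : ℕ) : qFactInv B (n + 1) * (1 - X ^ (n + 1)) = qFactInv B n := by
  have h1 := qPoch_one_mul_qFactInv (B := B) n
  have h2 := qPoch_one_mul_qFactInv (B := B) (n + 1)
  rw [qPoch_succ, one_smul] at h2
  linear_combination qFactInv B n * h2 - qFactInv B (n + 1) * (1 - X ^ (n + 1)) * h1

theorem X_pow_dvd_smul_X_pow (a : B) {m n : ℕ} (h : m ≤ n) : (X : B⟦X⟧) ^ m ∣ a • X ^ n :=
  dvd_smul_of_dvd a (pow_dvd_pow X h)

/-- The general term of the `q`-binomial series. -/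
noncomputable def qBinomTerm (a y : B) (k j : ℕ) : B⟦X⟧ :=
  qPoch a j * qFactInv B j * (y • X ^ (k + 1)) ^ j

theorem X_pow_dvd_qBinomTerm (a y : B) (k j : ℕ) : X ^ ((k + 1) * j) ∣ qBinomTerm a y k j := by
  refine Dvd.dvd.mul_left ?_ _
  rw [smul_pow, ← pow_mul]
  exact X_pow_dvd_smul_X_pow _ le_rfl

/-- Raising `k` replaces the argument `x` by `qx`. The factor `1 - q^{j+1}` so produced cancels the
last factor of `(q)_{j+1}`, and `1 - a q^{j+1}` splits into the two terms on the right. -/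
theorem qBinomTerm_succ (a y : B) (k j : ℕ) :
    qBinomTerm a y k (j + 1) - qBinomTerm a y (k + 1) (j + 1) =
      y • X ^ (k + 1) * qBinomTerm a y k j -
        (a * y) • X ^ (k + 2) * qBinomTerm a y (k + 1) j := by
  simp only [qBinomTerm, qPoch_succ, ← qFactInv_succ j, smul_eq_C_mul, map_mul]
  ring

variable [TopologicalSpace B]

theorem tendsto_of_X_pow_dvd_sub {f : ℕ → B⟦X⟧} {g : B⟦X⟧} (h : ∀ n, X ^ n ∣ f n - g) :
    Tendsto f atTop (𝓝 g) := by
  rw [WithPiTopology.tendsto_iff_coeff_tendsto]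
  refine fun d => tendsto_atTop_of_eventually_const (i₀ := d + 1) fun n hn => ?_
  have := X_pow_dvd_iff.mp (h n) d (by lia)
  rwa [map_sub, sub_eq_zero] at this

theorem hasSum_of_coeff_eq_sum {f : ℕ → B⟦X⟧} {g : B⟦X⟧} (s : ℕ → Finset ℕ)
    (h0 : ∀ n, ∀ j ∉ s n, coeff n (f j) = 0) (hs : ∀ n, coeff n g = ∑ j ∈ s n, coeff n (f j)) :
    HasSum f g := by
  rw [WithPiTopology.hasSum_iff_hasSum_coeff]
  intro d
  rw [hs]
  exact hasSum_sum_of_ne_finset_zero (h0 d)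

theorem summable_of_X_pow_dvd {f : ℕ → B⟦X⟧} (h : ∀ j, X ^ j ∣ f j) : Summable f :=
  (hasSum_of_coeff_eq_sum (g := PowerSeries.mk fun n => ∑ j ∈ range (n + 1), coeff n (f j))
    (fun n => range (n + 1))
    (fun n j hj => X_pow_dvd_iff.mp (h j) n (by simpa using hj)) (by simp)).summable

theorem multipliable_one_sub_of_X_pow_dvd {f : ℕ → B⟦X⟧} (h : ∀ j, X ^ j ∣ f j) :
    Multipliable fun j => 1 - f j := by
  simp_rw [sub_eq_add_neg]
  apply WithPiTopology.multipliable_one_add_of_tendsto_order_atTop_nhds_top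
  refine ENat.tendsto_nhds_top_iff_natCast_lt.mpr fun n => eventually_atTop.mpr ⟨n + 1, ?_⟩
  intro m hm
  rw [order_neg]
  refine lt_of_lt_of_le (b := (m : ℕ∞)) (by exact_mod_cast hm) ?_
  exact nat_le_order _ _ (X_pow_dvd_iff.mp (h m))

theorem multipliable_one_sub_smul_X_pow (a : ℕ → B) (k : ℕ) :
    Multipliable fun i => (1 : B⟦X⟧) - a i • X ^ (i + k) :=
  multipliable_one_sub_of_X_pow_dvd fun _ => X_pow_dvd_smul_X_pow _ (by lia)

/-- The infinite product `∏_{i≥1} (1 - a q^i)`. -/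
noncomputable def qInf (a : B) : B⟦X⟧ := ∏' i : ℕ, (1 - a • X ^ (i + 1))

theorem hasProd_qInf (a : B) : HasProd (fun i : ℕ => (1 : B⟦X⟧) - a • X ^ (i + 1)) (qInf a) :=
  (multipliable_one_sub_smul_X_pow (fun _ => a) 1).hasProd

theorem tendsto_qPoch (a : B) : Tendsto (qPoch a) atTop (𝓝 (qInf a)) :=
  (hasProd_qInf a).tendsto_prod_nat

theorem summable_qBinomTerm (a y : B) (k : ℕ) : Summable (qBinomTerm a y k) :=
  summable_of_X_pow_dvd fun j =>
    (pow_dvd_pow X (Nat.le_mul_of_pos_left j k.succ_pos)).trans (X_pow_dvd_qBinomTerm a y k j)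

variable [T2Space B]

theorem X_pow_dvd_tsum {f : ℕ → B⟦X⟧} {m : ℕ} (hs : Summable f) (h : ∀ j, X ^ m ∣ f j) :
    X ^ m ∣ ∑' j, f j := by
  rw [X_pow_dvd_iff]
  intro d hd
  rw [hs.map_tsum (coeff d) (WithPiTopology.continuous_coeff B d)]
  simp [fun j => X_pow_dvd_iff.mp (h j) d hd]

variable [IsTopologicalRing B]

/-- The functional equation `F(x)(1 - x) = F(qx)(1 - aqx)` at `x = y q^{k+1}`. -/
theorem tsum_qBinomTerm_mul (a y : B) (k : ℕ) :
    (∑' j, qBinomTerm a y k j) * (1 - y • X ^ (k + 1)) =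
      (∑' j, qBinomTerm a y (k + 1) j) * (1 - (a * y) • X ^ (k + 2)) := by
  have h1 := (summable_qBinomTerm a y k).hasSum
  have h2 := (summable_qBinomTerm a y (k + 1)).hasSum
  have h3 := (hasSum_nat_add_iff' 1).mpr (h1.sub h2)
  simp only [qBinomTerm_succ] at h3
  have h4 := h3.unique ((h1.mul_left (y • X ^ (k + 1))).sub
    (h2.mul_left ((a * y) • X ^ (k + 2))))
  simp only [range_one, sum_singleton, qBinomTerm, pow_zero, sub_self, sub_zero] at h4 ⊢
  linear_combination h4

theorem tsum_qBinomTerm_mul_qPoch (a y : B) (n : ℕ) :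
    (∑' j, qBinomTerm a y 0 j) * qPoch y n =
      (∏ i ∈ range n, (1 - (a * y) • X ^ (i + 2))) * ∑' j, qBinomTerm a y n j := by
  induction n with
  | zero => simp
  | succ n ih =>
    rw [qPoch_succ, ← mul_assoc, ih, mul_assoc, tsum_qBinomTerm_mul, prod_range_succ]
    ring

/-- The `q`-binomial theorem. -/
theorem tsum_qBinomTerm_mul_qInf (a y : B) :
    (∑' j, qBinomTerm a y 0 j) * qInf y = ∏' i : ℕ, (1 - (a * y) • X ^ (i + 2)) := by
  -- The iterated functional equation leaves the factor `F(y q^{n+1})`, which tends to its initial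
  -- term `1`.
  have hlim : Tendsto (fun n => ∑' j, qBinomTerm a y n j) atTop (𝓝 1) := by
    refine tendsto_of_X_pow_dvd_sub fun n => ?_
    rw [(summable_qBinomTerm a y n).tsum_eq_zero_add]
    simp only [qBinomTerm, pow_zero, qPoch_zero, qFactInv_zero, mul_one, add_sub_cancel_left]
    refine X_pow_dvd_tsum ((summable_nat_add_iff 1).mpr (summable_qBinomTerm a y n)) fun j => ?_
    exact (pow_dvd_pow X (by nlinarith)).trans (X_pow_dvd_qBinomTerm a y n (j + 1))
  have h1 := (tendsto_qPoch y).const_mul (∑' j, qBinomTerm a y 0 j)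
  have h2 := (multipliable_one_sub_smul_X_pow (fun _ => a * y) 2).hasProd.tendsto_prod_nat.mul hlim
  simp only [tsum_qBinomTerm_mul_qPoch, mul_one] at h1 h2
  exact tendsto_nhds_unique h1 h2

theorem qInf_one_eq : qInf (1 : B) = (1 - X) * ∏' i : ℕ, (1 - (1 : B) • X ^ (i + 2)) := by
  have h := (multipliable_one_sub_smul_X_pow (fun _ => (1 : B)) 2).hasProd.zero_mul
    (f := fun i => (1 : B⟦X⟧) - (1 : B) • X ^ (i + 1))
  simpa [qInf] using h.tprod_eq

/-- For multiplicative weights each factor of the generating function is a geometric series `∑ w_i^c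
q^{ic}`. -/
theorem genFun_pow_mul_tprod (w : ℕ → B) :
    Nat.Partition.genFun (fun i c => w i ^ c) * ∏' i : ℕ, (1 - w (i + 1) • X ^ (i + 1)) = 1 := by
  have h := (Nat.Partition.hasProd_genFun fun i c => w i ^ c).mul
    (multipliable_one_sub_smul_X_pow (fun i => w (i + 1)) 1).hasProd
  refine h.unique ?_
  convert! hasProd_one (α := B⟦X⟧) (β := ℕ) using 2 with i
  have h0 : constantCoeff (w (i + 1) • X ^ (i + 1) : B⟦X⟧) = 0 := by simp [smul_eq_C_mul]
  have h1 := WithPiTopology.tsum_pow_mul_one_sub_of_constantCoeff_eq_zero h0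
  rw [(WithPiTopology.summable_pow_of_constantCoeff_eq_zero h0).tsum_eq_zero_add] at h1
  simpa [smul_pow, ← pow_mul] using h1

end QSeries

/-! ### Partitions sorted by their number of ones -/

section Combinatorics

variable {B : Type*} [CommRing B]

theorem count_one_le {n : ℕ} (p : n.Partition) : p.parts.count 1 ≤ n := by
  have h := Multiset.le_count_iff_replicate_le.mp (le_refl (p.parts.count 1))
  obtain ⟨t, ht⟩ := Multiset.le_iff_exists_add.mp h
  have h2 := congrArg Multiset.sum ht
  simp only [p.parts_sum, Multiset.sum_add, Multiset.sum_replicate, smul_eq_mul, mul_one] at h2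
  lia

/-- The weight of a part for partitions without ones in which the parts larger than `j` are
counted by `z`. -/
def partWeight (z : B) (j i : ℕ) : B := if i = 1 then 0 else if i ≤ j then 1 else z

/-- The generating function of partitions without ones, in which the parts larger than `j` are
counted by `z`. -/
noncomputable def noOnesGen (z : B) (j : ℕ) : B⟦X⟧ :=
  Nat.Partition.genFun fun i c => partWeight z j i ^ c

theorem prod_map_ite_le (s : Multiset ℕ) (z : B) (j : ℕ) :
    (s.map fun i => if i ≤ j then 1 else z).prod = z ^ s.countP (j < ·) := by
  induction s using Multiset.induction_on with
  | empty => simp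
  | cons a s ih =>
    rw [Multiset.map_cons, Multiset.prod_cons, ih, Multiset.countP_cons]
    by_cases h : a ≤ j
    · simp [h, not_lt.mpr h]
    · simp [h, not_le.mp h, pow_succ']

theorem coeff_noOnesGen (z : B) (j n : ℕ) :
    coeff n (noOnesGen z j) = ∑ p : n.Partition,
      if p.parts.count 1 = 0 then z ^ p.parts.countP (j < ·) else 0 := by
  rw [noOnesGen, Nat.Partition.coeff_genFun]
  refine sum_congr rfl fun p _ => ?_
  simp only [Finsupp.prod, Multiset.toFinsupp_support, Multiset.toFinsupp_apply]
  rw [← prod_multiset_map_count]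
  split_ifs with h
  · rw [← prod_map_ite_le]
    refine congrArg Multiset.prod (Multiset.map_congr rfl fun i hi => ?_)
    have : i ≠ 1 := by
      rintro rfl
      exact Multiset.count_eq_zero.mp h hi
    simp [partWeight, this]
  · refine Multiset.prod_eq_zero (Multiset.mem_map.mpr ⟨1, ?_, by simp [partWeight]⟩)
    by_contra h1
    exact h (Multiset.count_eq_zero.mpr h1)

/-- `genFun` multiplies only over the parts that occur, so a partition without ones gets no factor
at `1`; hence the first alternative in the condition. -/
theorem coeff_genFun_ones {z : B} {j : ℕ} (hj : 1 ≤ j) (n : ℕ) :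
    coeff n (Nat.Partition.genFun fun i c => if i = 1 then (if c = j then 1 else 0)
      else partWeight z j i ^ c) = ∑ p : n.Partition,
      if p.parts.count 1 = 0 ∨ p.parts.count 1 = j then z ^ p.parts.countP (j < ·) else 0 := by
  rw [Nat.Partition.coeff_genFun]
  refine sum_congr rfl fun p _ => ?_
  simp only [Finsupp.prod, Multiset.toFinsupp_support, Multiset.toFinsupp_apply]
  have hterm : ∀ i ∈ p.parts.toFinset,
      (if i = 1 then (if p.parts.count i = j then (1 : B) else 0)
        else partWeight z j i ^ p.parts.count i) =
      (if 1 = i then (if p.parts.count 1 = j then (1 : B) else 0) else 1) *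
        (if i ≤ j then 1 else z) ^ p.parts.count i := by
    intro i _
    by_cases hi : i = 1
    · subst hi
      simp [hj]
    · simp [partWeight, hi, Ne.symm hi]
  refine (prod_congr rfl hterm).trans ?_
  rw [prod_mul_distrib, ← prod_multiset_map_count, prod_map_ite_le,
    prod_ite_eq]
  simp only [Multiset.mem_toFinset, ← Multiset.count_ne_zero]
  grind

variable [TopologicalSpace B] [IsTopologicalRing B] [T2Space B]

/-- The generating function is the inverse of `∏_{2≤i≤j} (1 - q^i) ∏_{i>j} (1 - z q^i)`. Multiplying
by `(zq)_∞` cancels the tail, and the factor `1 - X` restores the missing part `1`. -/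
theorem noOnesGen_mul_qInf (z : B) {j : ℕ} (hj : 1 ≤ j) :
    noOnesGen z j * qInf z = (1 - X) * (qPoch z j * qFactInv B j) := by
  set T : B⟦X⟧ := ∏' i : ℕ, (1 - z • X ^ (i + (j + 1))) with hT
  have hm : HasProd (fun i => (1 : B⟦X⟧) - z • X ^ (i + (j + 1))) T :=
    (multipliable_one_sub_smul_X_pow (fun _ => z) (j + 1)).hasProd
  have h1 : qInf z = qPoch z j * T := by
    refine (hasProd_qInf z).unique ?_
    have := HasProd.prod_range_mul (f := fun i => (1 : B⟦X⟧) - z • X ^ (i + 1)) (k := j) (m := T)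
      (by simpa [add_assoc] using hm)
    exact this
  have h2 : ∏' i : ℕ, (1 - partWeight z j (i + 1) • (X : B⟦X⟧) ^ (i + 1)) =
      (∏ i ∈ range j, (1 - partWeight z j (i + 1) • X ^ (i + 1))) * T := by
    refine ((multipliable_one_sub_smul_X_pow (fun i => partWeight z j (i + 1)) 1).hasProd).unique ?_
    refine HasProd.prod_range_mul
      (f := fun i => (1 : B⟦X⟧) - partWeight z j (i + 1) • X ^ (i + 1)) ?_
    convert! hm using 4 with i
    simp only [partWeight]
    rw [if_neg (by lia), if_neg (by lia)]
  have h3 : (1 - X) * ∏ i ∈ range j, (1 - partWeight z j (i + 1) • (X : B⟦X⟧) ^ (i + 1)) =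
      qPoch 1 j := by
    obtain ⟨k, rfl⟩ := Nat.exists_eq_add_of_le' hj
    rw [qPoch, prod_range_succ', prod_range_succ', mul_comm]
    simp only [partWeight]
    congr 1
    · simp only [zero_add, ↓reduceIte, zero_smul, sub_zero, mul_one]
      refine prod_congr rfl fun i hi => ?_
      rw [if_neg (by lia), if_pos (by simp at hi; lia)]
    · simp
  have h4 := genFun_pow_mul_tprod (partWeight z j)
  rw [← noOnesGen, h2] at h4
  have h5 := qPoch_one_mul_qFactInv (B := B) j
  rw [h1]
  rw [← h3] at h5
  linear_combination (1 - X) * qPoch z j * qFactInv B j * h4 - noOnesGen z j * qPoch z j * T * h5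

/-- Allowing either no ones or exactly `j` ones multiplies `noOnesGen` by `1 + X ^ j`; subtracting
the case of no ones isolates the other. -/
theorem coeff_X_pow_mul_noOnesGen (z : B) {j : ℕ} (hj : 1 ≤ j) (n : ℕ) :
    coeff n (X ^ j * noOnesGen z j) = ∑ p : n.Partition,
      if p.parts.count 1 = j then z ^ p.parts.countP (j < ·) else 0 := by
  have h : Nat.Partition.genFun (fun i c => if i = 1 then (if c = j then 1 else 0)
      else partWeight z j i ^ c) = noOnesGen z j * (1 + X ^ j) := by
    refine (Nat.Partition.hasProd_genFun _).unique ?_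
    convert! (Nat.Partition.hasProd_genFun fun i c => partWeight z j i ^ c).mul
      (hasProd_ite_eq 0 (1 + X ^ j : B⟦X⟧)) using 2 with i
    rcases eq_or_ne i 0 with rfl | hi
    · rw [tsum_eq_single (j - 1) fun c hc => by simp [show c + 1 ≠ j by lia]]
      simp [partWeight, Nat.sub_add_cancel hj]
    · simp [hi]
  have h2 : X ^ j * noOnesGen z j = Nat.Partition.genFun (fun i c => if i = 1 then
      (if c = j then 1 else 0) else partWeight z j i ^ c) - noOnesGen z j := by
    rw [h]
    ring
  rw [h2, map_sub, coeff_genFun_ones hj, coeff_noOnesGen, ← sum_sub_distrib]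
  refine sum_congr rfl fun p _ => ?_
  grind

end Combinatorics

/-! ### The product formula for the crank generating function -/

section Crank

variable {B : Type*} [CommRing B]

/-- The generating function of partitions without ones, whose largest part is marked by `z`. -/
noncomputable def largestPartGen (z : B) : B⟦X⟧ :=
  PowerSeries.mk fun n => ∑ p : n.Partition,
    if p.parts.count 1 = 0 then z ^ p.parts.sup else 0

/-- The generating function of partitions with at least one `1`, whose crank is marked by `z`. -/
noncomputable def onesCrankGen (z : Bˣ) : B⟦X⟧ :=
  PowerSeries.mk fun n => ∑ p : n.Partition,
    if p.parts.count 1 = 0 then 0 else ((z ^ crank p : Bˣ) : B)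

/-- The generating function of the crank, amended at `n = 1`. -/
noncomputable def crankGen (z : Bˣ) : B⟦X⟧ :=
  (PowerSeries.mk fun n => ∑ p : n.Partition, ((z ^ crank p : Bˣ) : B)) + ((z : B) - 1) • X

theorem crankGen_eq (z : Bˣ) :
    crankGen z = largestPartGen (z : B) + onesCrankGen z + ((z : B) - 1) • X := by
  rw [crankGen]
  congr 1
  ext n
  simp only [largestPartGen, onesCrankGen, coeff_mk, map_add, ← sum_add_distrib]
  refine sum_congr rfl fun p _ => ?_
  split_ifs with h
  · simp [crank, h]
  · simp

/-- At `z = 0`, `noOnesGen` therefore counts partitions without ones whose parts are at most `j`,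
and `supGen` is a difference of two of these. -/
theorem zero_pow_countP (s : Multiset ℕ) (j : ℕ) :
    (0 : B) ^ s.countP (j < ·) = if s.sup ≤ j then 1 else 0 := by
  rw [zero_pow_eq]
  refine if_congr ?_ rfl rfl
  simp [Multiset.countP_eq_zero, Multiset.sup_le]

theorem qPoch_zero_left (n : ℕ) : qPoch (0 : B) n = 1 := by simp [qPoch]

/-- The generating function of partitions without ones and with largest part `m`. -/
noncomputable def supGen (B : Type*) [CommRing B] (m : ℕ) : B⟦X⟧ :=
  PowerSeries.mk fun n => ∑ p : n.Partition,
    if p.parts.count 1 = 0 ∧ p.parts.sup = m then 1 else 0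

theorem supGen_succ (m : ℕ) :
    supGen B (m + 1) = noOnesGen 0 (m + 1) - noOnesGen 0 m := by
  ext n
  simp only [supGen, coeff_mk, map_sub, coeff_noOnesGen, zero_pow_countP, ← sum_sub_distrib]
  refine sum_congr rfl fun p _ => ?_
  split_ifs <;> first | lia | simp

variable [TopologicalSpace B]

theorem qInf_zero : qInf (0 : B) = 1 := by simp [qInf]

theorem hasSum_largestPartGen (z : B) :
    HasSum (fun m : ℕ => z ^ m • supGen B m) (largestPartGen z) := by
  have hsup {n : ℕ} (p : n.Partition) : p.parts.sup ≤ n := by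
    refine Multiset.sup_le.mpr fun i hi => ?_
    rw [← p.parts_sum]
    exact Multiset.single_le_sum (fun _ _ => Nat.zero_le _) _ hi
  refine hasSum_of_coeff_eq_sum (fun n => range (n + 1)) (fun n j hj => ?_) (fun n => ?_)
  · rw [coeff_smul, supGen, coeff_mk, sum_eq_zero, smul_zero]
    refine fun p _ => if_neg ?_
    have := hsup p
    simp at hj
    lia
  · simp only [largestPartGen, supGen, coeff_mk, coeff_smul, smul_eq_mul, mul_sum]
    rw [sum_comm]
    refine sum_congr rfl fun p _ => ?_
    have := hsup p
    split_ifs with h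
    · rw [sum_eq_single p.parts.sup (fun j _ hj => by simp [Ne.symm hj])
        (fun hj => absurd (mem_range.mpr (by lia)) hj)]
      simp [h]
    · simp [h]

variable [IsTopologicalRing B] [T2Space B]

theorem hasSum_onesCrankGen (z : Bˣ) :
    HasSum (fun j : ℕ => (((z⁻¹ : Bˣ) : B) • X) ^ (j + 1) * noOnesGen (z : B) (j + 1))
      (onesCrankGen z) := by
  have hc (n j : ℕ) : coeff n ((((z⁻¹ : Bˣ) : B) • X) ^ (j + 1) * noOnesGen (z : B) (j + 1)) =
      ∑ p : n.Partition, if p.parts.count 1 = j + 1 then ((z ^ crank p : Bˣ) : B) else 0 := by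
    rw [smul_pow, smul_mul_assoc, coeff_smul, coeff_X_pow_mul_noOnesGen _ (by lia), smul_eq_mul,
      mul_sum]
    refine sum_congr rfl fun p _ => ?_
    split_ifs with h
    · rw [crank, if_neg (by lia), h, zpow_sub, zpow_natCast, zpow_natCast]
      simp [mul_comm]
    · simp
  refine hasSum_of_coeff_eq_sum (fun n => range n) (fun n j hj => ?_) (fun n => ?_)
  · rw [hc]
    refine sum_eq_zero fun p _ => if_neg ?_
    have := count_one_le p
    simp at hj
    lia
  · simp only [hc, onesCrankGen, coeff_mk]
    rw [sum_comm]
    refine sum_congr rfl fun p _ => ?_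
    have := count_one_le p
    split_ifs with h
    · exact (sum_eq_zero fun j _ => if_neg (by lia)).symm
    · rw [sum_eq_single (p.parts.count 1 - 1) (fun j _ hj => if_neg (by lia))
        (fun hj => absurd (mem_range.mpr (by lia)) hj), if_pos (by lia)]

theorem noOnesGen_zero {j : ℕ} (hj : 1 ≤ j) :
    noOnesGen (0 : B) j = (1 - X) * qFactInv B j := by
  simpa [qInf_zero, qPoch_zero_left] using noOnesGen_mul_qInf (0 : B) hj

theorem noOnesGen_zero_zero : noOnesGen (0 : B) 0 = 1 := by
  have h := genFun_pow_mul_tprod (partWeight (0 : B) 0)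
  simpa [partWeight, noOnesGen] using h

theorem supGen_zero : supGen B 0 = 1 := by
  rw [← noOnesGen_zero_zero]
  ext n
  simp only [supGen, coeff_mk, coeff_noOnesGen, zero_pow_countP]
  refine sum_congr rfl fun p _ => ?_
  split_ifs <;> lia

/-- The uniform formula fails only at `m = 0`, where it gives `1 - X` in place of `1`, and at `m =
1`, where it gives `X` in place of `0`. -/
theorem supGen_eq (m : ℕ) :
    supGen B m = (1 - X) * qFactInv B m * X ^ m +
      ((if m = 0 then X else 0) - (if m = 1 then X else 0)) := by
  rcases m with _ | _ | m
  · simp [supGen_zero]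
  · have h := qFactInv_succ (B := B) 0
    rw [supGen_succ, noOnesGen_zero_zero, noOnesGen_zero (by lia)]
    simp only [zero_add, pow_one, qFactInv_zero] at h ⊢
    simp
    linear_combination (1 - X) * h
  · rw [supGen_succ, noOnesGen_zero (by lia), noOnesGen_zero (by lia), ← qFactInv_succ (m + 1)]
    simp
    ring

/-- The correction `X - z • X` is exactly what the amendment of `crankGen` at `n = 1` cancels. -/
theorem largestPartGen_eq (z : B) :
    largestPartGen z = (1 - X) * ∑' j, qBinomTerm 0 z 0 j + (X - z • X) := by
  refine (hasSum_largestPartGen z).unique ?_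
  have h := ((summable_qBinomTerm 0 z 0).hasSum.mul_left (1 - X)).add
    ((hasSum_ite_eq 0 (X : B⟦X⟧)).sub (hasSum_ite_eq 1 (z • X : B⟦X⟧)))
  convert! h using 2 with m
  rw [supGen_eq, qBinomTerm, qPoch_zero_left]
  simp only [smul_add, smul_sub, smul_eq_C_mul, map_pow]
  rcases eq_or_ne m 0 with rfl | h0
  · simp
  rcases eq_or_ne m 1 with rfl | h1
  · simp
    ring
  · simp [h0, h1]
    ring

/-- The product formula of Andrews and Garvan for the generating function of the crank. -/
theorem crankGen_mul_qInf (z : Bˣ) :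
    crankGen z * (qInf (z : B) * qInf ((z⁻¹ : Bˣ) : B)) = qInf 1 := by
  -- Euler's case `a = 0` of the `q`-binomial theorem.
  have hE : (∑' j, qBinomTerm 0 (z : B) 0 j) * qInf (z : B) = 1 := by
    rw [tsum_qBinomTerm_mul_qInf]
    simp
  have hO : onesCrankGen z * qInf (z : B) =
      (1 - X) * (∑' j, qBinomTerm (z : B) ((z⁻¹ : Bˣ) : B) 0 j - 1) := by
    refine ((hasSum_onesCrankGen z).mul_right (qInf (z : B))).unique ?_
    have h := ((hasSum_nat_add_iff' 1).mpr
      (summable_qBinomTerm (z : B) ((z⁻¹ : Bˣ) : B) 0).hasSum).mul_left (1 - X)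
    simp only [range_one, sum_singleton] at h
    convert! h using 2
    · rw [mul_assoc, noOnesGen_mul_qInf _ (by lia), qBinomTerm, zero_add, pow_one]
      ring
    · simp [qBinomTerm]
  -- With `a = z` and `y = z⁻¹` one has `a y = 1`, so the right side is `(q)_∞ / (1 - q)`.
  have hS := tsum_qBinomTerm_mul_qInf (z : B) ((z⁻¹ : Bˣ) : B)
  rw [Units.mul_inv] at hS
  rw [qInf_one_eq, ← hS, crankGen_eq, largestPartGen_eq, sub_smul, one_smul]
  linear_combination (1 - X) * qInf ((z⁻¹ : Bˣ) : B) * hE + qInf ((z⁻¹ : Bˣ) : B) * hO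

end Crank

/-! ### Logarithmic derivatives of infinite products -/

section LogDeriv

variable {B : Type*} [CommRing B]

/-- The geometric series `∑_{c≥1} a^c q^{ic}`. -/
noncomputable def geomTerm (a : B) (i : ℕ) : B⟦X⟧ :=
  PowerSeries.mk fun n => if i ∣ n ∧ n ≠ 0 then a ^ (n / i) else 0

theorem geomTerm_mul (a : B) {i : ℕ} (hi : 1 ≤ i) :
    geomTerm a i * (1 - a • X ^ i) = a • X ^ i := by
  have h : geomTerm a i = a • X ^ i + a • (geomTerm a i * X ^ i) := by
    ext n
    simp only [geomTerm, coeff_mk, map_add, coeff_smul, coeff_X_pow, coeff_mul_X_pow', smul_eq_mul]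
    by_cases hn : i ≤ n
    · obtain ⟨k, rfl⟩ := Nat.exists_eq_add_of_le' hn
      rcases eq_or_ne k 0 with rfl | hk
      · simp [show i ≠ 0 by lia, Nat.div_self hi]
      · have : k + i ≠ i := by lia
        by_cases hd : i ∣ k
        · simp [hd, hk, Nat.add_div_right k hi, pow_succ']
        · simp [hd, hk]
    · rw [if_neg, if_neg (by lia), if_neg hn]
      · simp
      · exact fun h => hn (Nat.le_of_dvd (by lia) h.1)
  simp only [smul_eq_C_mul] at h ⊢
  linear_combination h

variable [Algebra ℂ B]

/-- The Lambert series `∑_{i,c≥1} ε(i) a^c q^{ic}`. -/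
noncomputable def lambert (ε : ℕ → ℂ) (a : B) : B⟦X⟧ :=
  PowerSeries.mk fun n => ∑ d ∈ n.divisors, ε d • a ^ (n / d)

variable [TopologicalSpace B]

theorem hasSum_lambert (ε : ℕ → ℂ) (a : B) :
    HasSum (fun i => ε (i + 1) • geomTerm a (i + 1)) (lambert ε a) := by
  refine hasSum_of_coeff_eq_sum (fun n => range n) (fun n j hj => ?_) (fun n => ?_)
  · rw [coeff_smul, geomTerm, coeff_mk, if_neg, smul_zero]
    rintro ⟨h1, h2⟩
    have := Nat.le_of_dvd (by lia) h1
    simp at hj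
    lia
  · simp only [lambert, geomTerm, coeff_mk, coeff_smul]
    rcases eq_or_ne n 0 with rfl | hn
    · simp
    rw [Nat.divisors, sum_filter, sum_Ico_eq_sum_range]
    refine sum_congr (by simp) fun i _ => ?_
    rw [add_comm 1 i]
    by_cases h : i + 1 ∣ n
    · rw [if_pos h, if_pos ⟨h, hn⟩]
    · rw [if_neg h, if_neg fun h' => h h'.1, smul_zero]

variable [IsTopologicalRing B] [T2Space B]

/-- Each factor `1 - a q^i` has logarithmic derivative `-ε(i)` times a geometric series; continuity
of `D` passes to the limit. The abstract `D` covers both `q d/dq`, with `ε(i) = i`, and `d/dt`, with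
`ε` constant. -/
theorem deriv_qInf (D : Derivation ℂ B⟦X⟧ B⟦X⟧) (hc : Continuous D) (ε : ℕ → ℂ) (a : B)
    (hD : ∀ i, 1 ≤ i → D (a • X ^ i) = ε i • (a • X ^ i)) :
    D (qInf a) = -(qInf a * lambert ε a) := by
  have hfin (n : ℕ) : D (qPoch a n) =
      -(qPoch a n * ∑ i ∈ range n, ε (i + 1) • geomTerm a (i + 1)) := by
    induction n with
    | zero => simp
    | succ n ih =>
      have h := geomTerm_mul a (i := n + 1) (by lia)
      rw [qPoch_succ, D.leibniz, ih, map_sub, hD _ (by lia), sum_range_succ]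
      rw [D.map_one_eq_zero]
      generalize a • (X : B⟦X⟧) ^ (n + 1) = x at h ⊢
      simp only [smul_eq_mul, Algebra.smul_def]
      linear_combination qPoch a n * algebraMap ℂ B⟦X⟧ (ε (n + 1)) * h
  have h1 := (hc.tendsto _).comp (tendsto_qPoch a)
  have h2 := ((tendsto_qPoch a).mul (hasSum_lambert ε a).tendsto_sum_nat).neg
  refine tendsto_nhds_unique h1 ?_
  convert! h2 using 2 with n
  exact hfin n

end LogDeriv

theorem P_mul_qInf : P * qInf (1 : ℂ) = 1 := by
  have h := genFun_pow_mul_tprod (fun _ => (1 : ℂ))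
  convert! h using 2
  ext n
  simp only [P, coeff_mk, Nat.Partition.coeff_genFun, Finsupp.prod, one_pow, prod_const_one,
    sum_const, card_univ, nsmul_eq_mul, mul_one]

theorem continuous_deltaDerivation : Continuous deltaDerivation := by
  rw [continuous_iff_continuousAt]
  intro f
  refine (WithPiTopology.tendsto_iff_coeff_tendsto _ _ _ _).mpr fun d => ?_
  simp only [deltaDerivation_apply, coeff_deltaQ]
  exact ((WithPiTopology.continuous_coeff ℂ d).tendsto f).const_mul _

theorem lambert_natCast_one : lambert (fun d => (d : ℂ)) (1 : ℂ) = Phi 1 := by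
  ext n
  simp [lambert, Phi]

/-- The logarithmic derivative of the partition generating function is `Φ_1`. -/
theorem deltaQ_P : deltaQ P = P * Phi 1 := by
  have h1 : deltaDerivation (qInf (1 : ℂ)) = -(qInf 1 * Phi 1) := by
    rw [← lambert_natCast_one]
    refine deriv_qInf _ continuous_deltaDerivation _ _ fun i _ => ?_
    ext n
    rw [deltaDerivation_apply, coeff_deltaQ]
    simp only [one_smul, coeff_smul, coeff_X_pow, smul_eq_mul]
    split_ifs with h <;> simp [h]
  have h2 : deltaDerivation (P * qInf (1 : ℂ)) = 0 := by rw [P_mul_qInf]; simp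
  rw [Derivation.leibniz, h1, smul_eq_mul, smul_eq_mul] at h2
  rw [← deltaDerivation_apply]
  linear_combination P * h2 + (P * Phi 1 - deltaDerivation P) * P_mul_qInf

/-! ### The substitution `z = e^t` and the `t`-derivative -/

/-- The exponential series as a unit of `ℂ⟦t⟧`. -/
noncomputable def expUnit : ℂ⟦X⟧ˣ where
  val := rescale 1 (exp ℂ)
  inv := rescale (-1) (exp ℂ)
  val_inv := by rw [exp_mul_exp_eq_exp_add]; simp
  inv_val := by rw [exp_mul_exp_eq_exp_add]; simp

theorem expUnit_zpow (k : ℤ) : ((expUnit ^ k : ℂ⟦X⟧ˣ) : ℂ⟦X⟧) = rescale (k : ℂ) (exp ℂ) := by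
  cases k with
  | ofNat n =>
    simp [expUnit, exp_pow_eq_rescale_exp]
  | negSucc n =>
    rw [zpow_negSucc, ← inv_pow, Units.val_pow_eq_pow_val]
    change (rescale (-1) (exp ℂ)) ^ (n + 1) = _
    rw [← map_pow, exp_pow_eq_rescale_exp, rescale_rescale]
    simp

theorem coeff_rescale_exp (c : ℂ) (j : ℕ) :
    coeff j (rescale c (exp ℂ)) = c ^ j / (j.factorial : ℂ) := by
  simp [coeff_rescale, coeff_exp, div_eq_mul_inv]

theorem derivative_rescale_exp (c : ℂ) :
    derivative ℂ (rescale c (exp ℂ)) = c • rescale c (exp ℂ) := by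
  ext j
  rw [coeff_derivative, coeff_smul, coeff_rescale_exp, coeff_rescale_exp, Nat.factorial_succ]
  have h1 : (j : ℂ) + 1 ≠ 0 := by exact_mod_cast j.succ_ne_zero
  have h2 : (j.factorial : ℂ) ≠ 0 := by exact_mod_cast j.factorial_ne_zero
  push_cast
  simp only [smul_eq_mul]
  field

/-- The derivation `d/dt` of `ℂ⟦t⟧⟦q⟧`, acting on the coefficients. -/
noncomputable def coeffDerivation : Derivation ℂ ℂ⟦X⟧⟦X⟧ ℂ⟦X⟧⟦X⟧ :=
  Derivation.mk'
    { toFun f := PowerSeries.mk fun n => derivative ℂ (coeff n f)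
      map_add' f g := by ext1 n; simp
      map_smul' c f := by ext1 n; simp }
    fun f g => by
      ext1 n
      rw [smul_eq_mul, smul_eq_mul, mul_comm g]
      simp only [LinearMap.coe_mk, AddHom.coe_mk, coeff_mk, map_add, coeff_mul, map_sum,
        Derivation.leibniz, sum_add_distrib, smul_eq_mul]
      exact congrArg _ (sum_congr rfl fun x _ => mul_comm _ _)

theorem coeff_coeffDerivation (f : ℂ⟦X⟧⟦X⟧) (n : ℕ) :
    coeff n (coeffDerivation f) = derivative ℂ (coeff n f) := by
  simp [coeffDerivation]

theorem continuous_coeffDerivation : Continuous coeffDerivation := by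
  rw [continuous_iff_continuousAt]
  intro f
  refine (WithPiTopology.tendsto_iff_coeff_tendsto _ _ _ _).mpr fun n => ?_
  refine (WithPiTopology.tendsto_iff_coeff_tendsto _ _ _ _).mpr fun j => ?_
  simp only [coeff_coeffDerivation, coeff_derivative]
  refine Tendsto.mul_const _ ?_
  exact (((WithPiTopology.continuous_coeff ℂ (j + 1)).comp
    (WithPiTopology.continuous_coeff ℂ⟦X⟧ n)).tendsto f)

theorem coeffDerivation_qInf (c : ℂ) :
    coeffDerivation (qInf (rescale c (exp ℂ))) =
      -(qInf (rescale c (exp ℂ)) * lambert (fun _ => c) (rescale c (exp ℂ))) := by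
  refine deriv_qInf _ continuous_coeffDerivation _ _ fun i _ => ?_
  ext1 n
  rw [coeff_coeffDerivation, coeff_smul, coeff_smul, coeff_X_pow]
  split_ifs with h <;> simp [h, derivative_rescale_exp]

/-- The logarithmic `t`-derivative of the crank generating function at `z = e^t`. -/
noncomputable def crankLog : ℂ⟦X⟧⟦X⟧ :=
  lambert (fun _ => 1) (rescale 1 (exp ℂ)) + lambert (fun _ => -1) (rescale (-1) (exp ℂ))

theorem coeffDerivation_crankGen :
    coeffDerivation (crankGen expUnit) = crankGen expUnit * crankLog := by
  have h := crankGen_mul_qInf expUnit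
  have hz : (expUnit : ℂ⟦X⟧) = rescale 1 (exp ℂ) := rfl
  have hw : ((expUnit⁻¹ : ℂ⟦X⟧ˣ) : ℂ⟦X⟧) = rescale (-1) (exp ℂ) := rfl
  rw [hz, hw] at h
  -- Needed to cancel in the domain `ℂ⟦t⟧⟦q⟧`: if the product vanished, so would `(q)_∞`.
  have hne : qInf (rescale 1 (exp ℂ)) * qInf (rescale (-1) (exp ℂ)) ≠ 0 := by
    intro h0
    rw [h0, mul_zero] at h
    refine WithPiTopology.tprod_one_sub_X_pow_ne_zero ℂ⟦X⟧ ?_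
    simpa [qInf] using h.symm
  -- Read `1` as `e^{0t}`, the case `c = 0` of `coeffDerivation_qInf`.
  have h1 : coeffDerivation (qInf (1 : ℂ⟦X⟧)) = 0 := by
    have h0 : lambert (fun _ => (0 : ℂ)) (1 : ℂ⟦X⟧) = 0 := by
      ext1 n
      simp [lambert]
    simpa [h0] using coeffDerivation_qInf 0
  rw [← h] at h1
  simp only [Derivation.leibniz, coeffDerivation_qInf, smul_eq_mul] at h1
  refine mul_right_cancel₀ hne ?_
  rw [crankLog]
  linear_combination h1

/-! ### Taylor coefficients in `t` and the crank moments -/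

/-- The coefficient of `t^j` in an element of `ℂ⟦t⟧⟦q⟧`, as a series in `q`. -/
noncomputable def tCoeff (j : ℕ) (f : ℂ⟦X⟧⟦X⟧) : ℂ⟦X⟧ :=
  PowerSeries.mk fun n => coeff j (coeff n f)

theorem tCoeff_mul (j : ℕ) (f g : ℂ⟦X⟧⟦X⟧) :
    tCoeff j (f * g) = ∑ x ∈ antidiagonal j, tCoeff x.1 f * tCoeff x.2 g := by
  ext n
  simp only [tCoeff, coeff_mk, coeff_mul, map_sum]
  exact sum_comm

theorem tCoeff_coeffDerivation (j : ℕ) (f : ℂ⟦X⟧⟦X⟧) :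
    tCoeff j (coeffDerivation f) = ((j : ℂ) + 1) • tCoeff (j + 1) f := by
  ext n
  simp [tCoeff, coeff_coeffDerivation, coeff_derivative, mul_comm]

/-- The Lambert series have coefficients `∑ e^{td}` and `-∑ e^{-td}` over the divisors `d` of `n`;
their even powers of `t` cancel and the odd ones double. -/
theorem tCoeff_crankLog (j : ℕ) :
    tCoeff j crankLog = ((1 - (-1) ^ j) / (j.factorial : ℂ)) • Phi j := by
  ext n
  have hpow (c : ℂ) (d : ℕ) : rescale c (exp ℂ) ^ d = rescale (d * c) (exp ℂ) := by
    rw [← map_pow, exp_pow_eq_rescale_exp, rescale_rescale, mul_comm]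
  simp only [tCoeff, crankLog, lambert, Phi, coeff_mk, map_add, map_sum, coeff_smul, hpow,
    coeff_rescale_exp, smul_eq_mul]
  rw [Nat.sum_div_divisors n fun d => 1 * (((d : ℂ) * 1) ^ j / (j.factorial : ℂ)),
    Nat.sum_div_divisors n fun d => -1 * (((d : ℂ) * -1) ^ j / (j.factorial : ℂ)),
    ← sum_add_distrib, mul_sum]
  refine sum_congr rfl fun d _ => ?_
  rw [mul_pow, mul_pow]
  ring

theorem crank_partition_one (p : Nat.Partition 1) : crank p = -1 := by
  simp [crank, Multiset.countP_eq_zero]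

/-- At `n = 1` the amended values contribute `-0^j + 1 + (-1)^j`, while the only partition has crank
`-1`; the difference is `1 - 0^j`. -/
theorem crankMoment_eq (j n : ℕ) :
    crankMoment j n = ∑ p : n.Partition, crank p ^ j + if n = 1 then 1 - 0 ^ j else 0 := by
  rw [crankMoment]
  by_cases hn : n = 1
  · subst hn
    rw [finsum_eq_sum_of_support_subset (s := {0, 1, -1})]
    · simp [M, crank_partition_one]
      ring
    · intro k hk
      by_contra h
      simp at h hk
      simp [M, h] at hk
  · have hM (k : ℤ) : k ^ j * M k n =
        ∑ p : n.Partition, if crank p = k then crank p ^ j else 0 := by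
      rw [M, if_neg hn, card_filter]
      push_cast
      rw [mul_sum]
      refine sum_congr rfl fun p _ => ?_
      split_ifs with h <;> simp [h]
    rw [if_neg hn, add_zero, finsum_eq_sum_of_support_subset (s := univ.image (crank (n := n)))]
    · simp only [hM]
      rw [sum_comm]
      refine sum_congr rfl fun p _ => ?_
      rw [sum_ite_eq, if_pos (mem_image_of_mem _ (mem_univ p))]
    · intro k hk
      by_contra h
      simp only [coe_image, coe_univ, Set.image_univ, Set.mem_range, not_exists] at h
      refine hk ?_
      simp only
      rw [hM]
      exact sum_eq_zero fun p _ => if_neg (h p)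

theorem coeff_tCoeff_crankGen (j n : ℕ) :
    coeff n (tCoeff j (crankGen expUnit)) = crankMoment j n / (j.factorial : ℂ) := by
  simp only [tCoeff, crankGen, coeff_mk, map_add, map_sum, expUnit_zpow, coeff_rescale_exp,
    crankMoment_eq, coeff_smul, coeff_X]
  push_cast
  rw [add_div, sum_div]
  congr 1
  have hz : (expUnit : ℂ⟦X⟧) = rescale 1 (exp ℂ) := rfl
  rcases eq_or_ne n 1 with rfl | hn
  · rw [hz]
    rcases eq_or_ne j 0 with rfl | hj
    · simp
    · simp [coeff_exp, coeff_one, hj]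
  · simp [hn]

theorem tCoeff_zero_crankGen : tCoeff 0 (crankGen expUnit) = P := by
  ext n
  rw [coeff_tCoeff_crankGen, crankMoment_eq]
  simp [P]

theorem tCoeff_crankGen {j : ℕ} (hj : j ≠ 0) :
    C j = (j.factorial : ℂ) • tCoeff j (crankGen expUnit) := by
  have hf : (j.factorial : ℂ) ≠ 0 := by exact_mod_cast j.factorial_ne_zero
  ext n
  rw [coeff_smul, coeff_tCoeff_crankGen, smul_eq_mul, mul_div_cancel₀ _ hf, C, coeff_mk]
  split_ifs with h
  · rfl
  · obtain rfl : n = 0 := by lia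
    rw [crankMoment_eq]
    simp [crank, hj]

/-- The recurrence of Atkin and Garvan for the crank moments. -/
theorem tCoeff_crankGen_succ (j : ℕ) :
    ((j : ℂ) + 1) • tCoeff (j + 1) (crankGen expUnit) = ∑ x ∈ antidiagonal j,
      tCoeff x.1 (crankGen expUnit) * ((1 - (-1) ^ x.2) / (x.2.factorial : ℂ)) • Phi x.2 := by
  rw [← tCoeff_coeffDerivation, coeffDerivation_crankGen, tCoeff_mul]
  simp only [tCoeff_crankLog]

/-- In the recurrence only odd `x.2 = 2k + 1` survive. Such a factor adds `k + 1` to the weight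
while the degree in `t` rises by `2k + 2`, so the weight stays at most half the degree. -/
theorem tCoeff_crankGen_mem (j : ℕ) :
    ∃ u ∈ U (j / 2), tCoeff j (crankGen expUnit) = P * u ∧ (Odd j → u = 0) := by
  induction j using Nat.strong_induction_on with | h j ih =>
  rcases j with _ | j
  · exact ⟨1, one_mem_U _, by rw [tCoeff_zero_crankGen, mul_one], by simp⟩
  choose! u hu hPu hodd using ih
  have hj : (j : ℂ) + 1 ≠ 0 := by exact_mod_cast j.succ_ne_zero
  refine ⟨((j : ℂ) + 1)⁻¹ • ∑ x ∈ antidiagonal j,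
    u x.1 * ((1 - (-1) ^ x.2) / (x.2.factorial : ℂ)) • Phi x.2, ?_, ?_, ?_⟩
  · refine (U _).smul_mem _ (sum_mem fun x hx => ?_)
    have hx' := mem_antidiagonal.mp hx
    rcases Nat.even_or_odd' x.2 with ⟨k, hk | hk⟩
    · simp [hk]
    · have h1 := hu x.1 (by lia)
      have h2 : Phi x.2 ∈ U (k + 1) := by
        rw [hk]
        exact Phi_mem_U (k := k + 1) (by lia)
      exact U_mono (by lia) (mul_mem_U h1 ((U _).smul_mem _ h2))
  · have h := congrArg (((j : ℂ) + 1)⁻¹ • ·) (tCoeff_crankGen_succ j)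
    simp only [smul_smul, inv_mul_cancel₀ hj, one_smul] at h
    rw [h, mul_smul_comm, mul_sum]
    refine congrArg _ (sum_congr rfl fun x hx => ?_)
    have hx' := mem_antidiagonal.mp hx
    rw [hPu x.1 (by lia), mul_assoc]
  · intro ho
    rw [sum_eq_zero, smul_zero]
    intro x hx
    have hx' := mem_antidiagonal.mp hx
    rcases Nat.even_or_odd x.2 with hk | hk
    · simp [hk.neg_one_pow]
    · rw [hodd x.1 (by lia) (by grind), zero_mul]

/-! ### Crank moments and their derivatives as multiples of `P` -/

theorem constantCoeff_P : constantCoeff P = 1 := by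
  rw [← coeff_zero_eq_constantCoeff_apply, P, coeff_mk]
  simp

theorem C_eq_P_mul {n : ℕ} (hn : 1 ≤ n) : ∃ Φ ∈ W n, C (2 * n) = P * Φ := by
  obtain ⟨u, hu, hPu, -⟩ := tCoeff_crankGen_mem (2 * n)
  rw [Nat.mul_div_cancel_left n two_pos] at hu
  have h : C (2 * n) = P * ((2 * n).factorial : ℂ) • u := by
    rw [tCoeff_crankGen (by lia), hPu, mul_smul_comm]
  refine ⟨_, mem_W_of_mem_U ((U n).smul_mem _ hu) ?_, h⟩
  -- `P` has constant term `1` and the moment series has none, so the cofactor has none either.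
  have h0 := congrArg constantCoeff h
  rw [map_mul, constantCoeff_P, one_mul] at h0
  rw [← h0, ← coeff_zero_eq_constantCoeff_apply, C, coeff_mk]
  simp

/-- The witness is `δ_q Φ + Φ_1 Φ`, by Leibniz and `deltaQ_P`; both summands gain one in weight and
have zero constant term. -/
theorem deltaQ_P_mul_mem {k : ℕ} {Φ : ℂ⟦X⟧} (h : Φ ∈ W k) :
    ∃ Ψ ∈ W (k + 1), deltaQ (P * Φ) = P * Ψ := by
  obtain ⟨hU, h0⟩ := mem_W_iff.mp h
  refine ⟨deltaQ Φ + Phi 1 * Φ, mem_W_iff.mpr ⟨add_mem (deltaQ_mem_U hU) ?_, ?_⟩, ?_⟩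
  · rw [add_comm k 1]
    exact mul_mem_U Phi_one_mem_U hU
  · simp [deltaQ]
  · rw [deltaQ_mul, deltaQ_P]
    ring

end CrankProduct

end CrankMoments

theorem theorem4p2 (m n : ℕ) (hn : 1 ≤ n) :
    ∃ Φ ∈ CrankMoments.W (n + m),
      CrankMoments.deltaQ^[m] (CrankMoments.C (2 * n)) = CrankMoments.P * Φ := by
  induction m with
  | zero => simpa using CrankMoments.C_eq_P_mul hn
  | succ m ih =>
    obtain ⟨Φ, hΦ, h⟩ := ih
    rw [Function.iterate_succ_apply', h]
    exact CrankMoments.deltaQ_P_mul_mem hΦ
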